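/- Let $\mathbb D$ be the open unit disc, $\mathbb T$ the unit circle, $H^2$ the Hardy space of $\mathbb D$ (identified through boundary values with a closed subspace of $L^2(\mathbb T)$), and $H^\infty$ the space of bounded analytic functions on $\mathbb D$. Let $P_+$ be the orthogonal projection of $L^2(\mathbb T)$ onto $H^2$, and for $a\in H^\infty$ let $\mathscr M(\overline a)=T_{\overline a}H^2=\{P_+(\overline a f): f\in H^2\}$, regarded as a space of analytic functions on $\mathbb D$. A multiplier from $\mathscr M(\overline{a_1})$ to $\mathscr M(\overline{a_2})$ is an analytic function $\varphi$ on $\mathbb D$ with $\varphi\,\mathscr M(\overline{a_1})\subset\mathscr M(\overline{a_2})$; it is onto if $\varphi\,\mathscr M(\overline{a_1})=\mathscr M(\overline{a_2})$. Let $\mathscr A$ be the set of polynomials $\prod_{j=1}^N (z-\zeta_j)$ with $N\ge 0$ and $\zeta_1,\dots,\zeta_N\in\mathbb T$ (not necessarily distinct). **Theorem.** Let $a_1,a_2\in\mathscr A$. 1. If $a_2/a_1$ belongs to $H^\infty$ and is not constant, then there is no multiplier from $\mathscr M(\overline{a_1})$ onto $\mathscr M(\overline{a_2})$. 2. If $a_1/a_2$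 belongs to $H^\infty$ and is not constant, then there is no multiplier from $\mathscr M(\overline{a_1})$ onto $\mathscr M(\overline{a_2})$. -/

import Mathlib

open MeasureTheory AddCircle Polynomial
open scoped ENNReal Complex.UnitDisc

noncomputable section

namespace RangeSpaces

/-! The unit circle is parametrized by `x ↦ e^{2πix}` (`AddCircle.toCircle`), `x ∈ ℝ/ℤ`, and carries
normalized Lebesgue (Haar) measure. -/

/-- `L²(𝕋)`. -/
abbrev L2 : Type := Lp ℂ 2 (haarAddCircle : Measure UnitAddCircle)

/-- `L^∞(𝕋)`. -/
abbrev LInf : Type := Lp ℂ ∞ (haarAddCircle : Measure UnitAddCircle)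

/-- The Hardy space `H²`, through its boundary functions: the `L²(𝕋)` functions whose Fourier
coefficients of negative index vanish. -/
def H2 : Submodule ℂ L2 where
  carrier := {f | ∀ n : ℤ, n < 0 → fourierCoeff f n = 0}
  zero_mem' := by
    intro n _
    rw [← fourierBasis_repr]
    simp
  add_mem' := by
    intro f g hf hg n hn
    have h1 := hf n hn
    have h2 := hg n hn
    rw [← fourierBasis_repr] at h1 h2 ⊢
    simp [h1, h2]
  smul_mem' := by
    intro c f hf n hn
    have h1 := hf n hn
    rw [← fourierBasis_repr] at h1 ⊢
    simp [h1]

theorem mem_H2_iff (f : L2) : f ∈ H2 ↔ ∀ n : ℤ, n < 0 → fourierCoeff f n = 0 := Iff.rfl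

theorem isClosed_H2 : IsClosed (H2 : Set L2) := by
  have h : (H2 : Set L2) =
      ⋂ n : ℤ, ⋂ _ : n < 0, {f : L2 | inner ℂ (fourierBasis n : L2) f = (0 : ℂ)} := by
    ext f
    simp only [SetLike.mem_coe, mem_H2_iff, Set.mem_iInter, Set.mem_ofPred_eq,
      ← fourierBasis_repr, HilbertBasis.repr_apply_apply]
  rw [h]
  refine isClosed_iInter fun n => isClosed_iInter fun _ => ?_
  exact isClosed_eq (continuous_const.inner continuous_id) continuous_const

instance : CompleteSpace H2 := isClosed_H2.completeSpace_coe

/-- The Toeplitz operator `T_g f = P₊(g f)` on `H²` with symbol `g ∈ L^∞(𝕋)`, where `P₊` is the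
orthogonal projection of `L²(𝕋)` onto `H²`. -/
def toeplitz (g : LInf) (f : H2) : H2 :=
  H2.orthogonalProjectionOnto ((g • (f : L2) : L2))

/-- The analytic function on the unit disc with boundary function `f ∈ H²`,
`z ↦ ∑_{n ≥ 0} f̂(n) zⁿ`. -/
def toDisc (f : H2) (z : 𝔻) : ℂ :=
  ∑' n : ℕ, fourierCoeff (f : L2) (n : ℤ) * (z : ℂ) ^ n

/-- The range space `𝓜(ā) = T_ā H²` of the Toeplitz operator with the conjugated symbol `ā`, as a
set of functions on the unit disc. -/
def rangeSpace (a : LInf) : Set (𝔻 → ℂ) :=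
  {F | ∃ f : H2, F = toDisc (toeplitz (star a) f)}

/-- A polynomial as a bounded function on the unit circle. -/
def bdry (p : ℂ[X]) : LInf :=
  ContinuousMap.toLp ∞ haarAddCircle ℂ
    (⟨fun x : UnitAddCircle => p.eval (toCircle x : ℂ), by fun_prop⟩ : C(UnitAddCircle, ℂ))

/-- Analytic functions on the open unit disc. -/
def IsAnalyticOnDisc (φ : 𝔻 → ℂ) : Prop :=
  ∃ F : ℂ → ℂ, DifferentiableOn ℂ F (Metric.ball 0 1) ∧ ∀ z : 𝔻, F z = φ z

/-- `H^∞`: bounded analytic functions on the open unit disc. -/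
def HInf : Set (𝔻 → ℂ) :=
  {h | IsAnalyticOnDisc h ∧ ∃ C : ℝ, ∀ z, ‖h z‖ ≤ C}

/-- The multipliers from one space of functions on the disc to another. -/
def multipliers (M₁ M₂ : Set (𝔻 → ℂ)) : Set (𝔻 → ℂ) :=
  {φ | IsAnalyticOnDisc φ ∧ ∀ f ∈ M₁, φ * f ∈ M₂}

/-- The class `𝒜` of polynomials `∏_{j=1}^N (z - ζ_j)` with all `ζ_j` on the unit circle. -/
def classA : Set ℂ[X] :=
  {a | ∃ (N : ℕ) (ζ : Fin N → Circle), a = ∏ j, (X - C (ζ j : ℂ))}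

/-- The quotient `p / q` as a function on the unit disc. -/
def quotient (p q : ℂ[X]) (z : 𝔻) : ℂ := p.eval (z : ℂ) / q.eval (z : ℂ)

end RangeSpaces

end

noncomputable section

namespace RangeSpaces

open Filter Topology ComplexConjugate

/-! ### Power series converging on the disc -/

/-! An onto multiplier `φ` forces the two range spaces to have the same self-multipliers: `1` lies
in the target, so `φ` has no zeros, and multiplication by `u` commutes with multiplication by `φ`
(`multiplies_iff_of_image_eq`). It remains to separate the spaces of `c` and `c * b` when `b` has a
zero `ζ` on the circle. In both parts the bounded nonconstant quotient is such a `b`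
(`exists_factor_of_quotient_mem_HInf`).

The range spaces are known well enough through `a H² ⊂ 𝓜(ā) ⊂ a H² + polynomials`, which follows
from `T_ā = ā(S*)` with `S*` the backward shift. Take `u = c k` with `k = (1 - ζ̄ z)^i`, bounded but
without radial limit at `ζ`. Since `k H² ⊂ H²`, `u` maps `𝓜(c̄)` into `c H²`, hence into itself. If
`u = u · 1` were `c b h + p`, then `k = b h + p / c`. Along the radius to `ζ` the term `b h` tends
to 0, because `h = o(1/(1-r))`, and `p / c` then stays bounded, hence converges; so `k` would
converge, which is false. -/

/-- Power series with square summable coefficients. -/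
def SqSummable (g : PowerSeries ℂ) : Prop := Summable fun n => ‖PowerSeries.coeff n g‖ ^ 2

/-- Power series converging absolutely on the open unit disc. -/
def DiscSummable (g : PowerSeries ℂ) : Prop :=
  ∀ z : ℂ, ‖z‖ < 1 → Summable fun n => ‖PowerSeries.coeff n g * z ^ n‖

/-- The sum of a power series at a point. -/
def discEval (g : PowerSeries ℂ) (z : ℂ) : ℂ := ∑' n : ℕ, PowerSeries.coeff n g * z ^ n

theorem SqSummable.discSummable {g : PowerSeries ℂ} (hg : SqSummable g) : DiscSummable g := by
  intro z hz
  have h2 : Summable fun n : ℕ => (‖z‖ ^ 2) ^ n :=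
    summable_geometric_of_lt_one (by positivity) (by nlinarith [norm_nonneg z])
  refine Summable.of_nonneg_of_le (fun n => norm_nonneg _) (fun n => ?_) (hg.add h2)
  rw [norm_mul, norm_pow, ← pow_mul, mul_comm 2 n, pow_mul]
  nlinarith [sq_nonneg (‖PowerSeries.coeff n g‖ - ‖z‖ ^ n),
    sq_nonneg (‖PowerSeries.coeff n g‖), sq_nonneg (‖z‖ ^ n)]

theorem sqSummable_coe (p : ℂ[X]) : SqSummable (p : PowerSeries ℂ) := by
  refine summable_of_ne_finset_zero (s := p.support) fun n hn => ?_
  simp [Polynomial.notMem_support_iff.mp hn]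

theorem SqSummable.add {g h : PowerSeries ℂ} (hg : SqSummable g) (hh : SqSummable h) :
    SqSummable (g + h) := by
  refine Summable.of_nonneg_of_le (fun n => by positivity) (fun n => ?_)
    ((Summable.mul_left 2 hg).add (Summable.mul_left 2 hh))
  rw [map_add]
  have h1 := norm_add_le (PowerSeries.coeff n g) (PowerSeries.coeff n h)
  nlinarith [sq_nonneg (‖PowerSeries.coeff n g‖ - ‖PowerSeries.coeff n h‖),
    norm_nonneg (PowerSeries.coeff n g + PowerSeries.coeff n h)]

theorem SqSummable.smul {g : PowerSeries ℂ} (c : ℂ) (hg : SqSummable g) :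
    SqSummable (c • g) := by
  refine (Summable.mul_left (‖c‖ ^ 2) hg).congr fun n => ?_
  simp [mul_pow]

theorem SqSummable.X_mul {g : PowerSeries ℂ} (hg : SqSummable g) :
    SqSummable (PowerSeries.X * g) := by
  refine (summable_nat_add_iff 1).mp ?_
  simpa [SqSummable] using hg

theorem SqSummable.coe_mul {g : PowerSeries ℂ} (hg : SqSummable g) (p : ℂ[X]) :
    SqSummable ((p : PowerSeries ℂ) * g) := by
  induction p using Polynomial.induction_on' with
  | add p q hp hq => rw [Polynomial.coe_add, add_mul]; exact hp.add hq
  | monomial n c =>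
    rw [← Polynomial.C_mul_X_pow_eq_monomial]
    induction n with
    | zero => simpa [← PowerSeries.smul_eq_C_mul] using hg.smul c
    | succ n ih =>
      convert ih.X_mul using 1
      push_cast
      ring

theorem discEval_add {g h : PowerSeries ℂ} (hg : DiscSummable g) (hh : DiscSummable h) {z : ℂ}
    (hz : ‖z‖ < 1) : discEval (g + h) z = discEval g z + discEval h z := by
  simp only [discEval, map_add, add_mul]
  exact (hg z hz).of_norm.tsum_add (hh z hz).of_norm

theorem coeff_mul_mul_pow (g h : PowerSeries ℂ) (z : ℂ) (n : ℕ) :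
    PowerSeries.coeff n (g * h) * z ^ n = ∑ kl ∈ Finset.HasAntidiagonal.antidiagonal n,
      (PowerSeries.coeff kl.1 g * z ^ kl.1) * (PowerSeries.coeff kl.2 h * z ^ kl.2) := by
  rw [PowerSeries.coeff_mul, Finset.sum_mul]
  refine Finset.sum_congr rfl fun kl hkl => ?_
  rw [← Finset.HasAntidiagonal.mem_antidiagonal.mp hkl, pow_add]
  ring

theorem DiscSummable.mul {g h : PowerSeries ℂ} (hg : DiscSummable g) (hh : DiscSummable h) :
    DiscSummable (g * h) := fun z hz => by
  simp only [coeff_mul_mul_pow]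
  exact summable_norm_sum_mul_antidiagonal_of_summable_norm
    (f := fun n => PowerSeries.coeff n g * z ^ n) (g := fun n => PowerSeries.coeff n h * z ^ n)
    (hg z hz) (hh z hz)

theorem discEval_mul {g h : PowerSeries ℂ} (hg : DiscSummable g) (hh : DiscSummable h) {z : ℂ}
    (hz : ‖z‖ < 1) : discEval (g * h) z = discEval g z * discEval h z := by
  simp only [discEval, coeff_mul_mul_pow]
  exact (tsum_mul_tsum_eq_tsum_sum_antidiagonal_of_summable_norm (hg z hz) (hh z hz)).symm

theorem discEval_coe (p : ℂ[X]) (z : ℂ) : discEval (p : PowerSeries ℂ) z = p.eval z := by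
  rw [discEval, tsum_eq_sum (s := p.support), Polynomial.eval_eq_sum, Polynomial.sum]
  · simp
  · intro n hn
    simp [Polynomial.notMem_support_iff.mp hn]

/-- Dominated convergence, term by term: `(1-r) rⁿ ≤ 1/(n+1)`, and `‖gₙ‖/(n+1)` is summable because
both factors are square summable. -/
theorem tendsto_one_sub_mul_discEval {g : PowerSeries ℂ} (hg : SqSummable g) {ζ : ℂ}
    (hζ : ‖ζ‖ = 1) :
    Tendsto (fun r : ℝ => ((1 - r : ℝ) : ℂ) * discEval g (r * ζ)) (𝓝[<] 1) (𝓝 0) := by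
  have hinv : Summable fun n : ℕ => (((n : ℝ) + 1)⁻¹) ^ 2 := by
    have := (summable_nat_add_iff 1).mpr (Real.summable_nat_pow_inv.mpr one_lt_two)
    simpa using this
  have hbd : Summable fun n : ℕ => ‖PowerSeries.coeff n g‖ * ((n : ℝ) + 1)⁻¹ := by
    refine Summable.of_nonneg_of_le (fun n => by positivity) (fun n => ?_) (Summable.add hg hinv)
    have h1 := two_mul_le_add_sq ‖PowerSeries.coeff n g‖ ((n : ℝ) + 1)⁻¹
    have h2 : 0 ≤ ‖PowerSeries.coeff n g‖ * ((n : ℝ) + 1)⁻¹ := by positivity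
    linarith
  have hI : ∀ᶠ r : ℝ in 𝓝[<] 1, r ∈ Set.Ioo (0 : ℝ) 1 := Ioo_mem_nhdsLT zero_lt_one
  have key := tendsto_tsum_of_dominated_convergence (𝓕 := 𝓝[<] (1 : ℝ))
    (f := fun (r : ℝ) (n : ℕ) => ((1 - r : ℝ) : ℂ) * (PowerSeries.coeff n g * (r * ζ) ^ n))
    (g := fun _ => (0 : ℂ)) hbd ?_ ?_
  · simpa [discEval, tsum_mul_left] using key
  · intro n
    have : Continuous fun r : ℝ =>
        ((1 - r : ℝ) : ℂ) * (PowerSeries.coeff n g * (r * ζ) ^ n) := by fun_prop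
    simpa using (this.tendsto 1).mono_left nhdsWithin_le_nhds
  · filter_upwards [hI] with r hr n
    have h1 : (1 - r) * r ^ n ≤ ((n : ℝ) + 1)⁻¹ := by
      rw [← one_div, le_div_iff₀ (by positivity)]
      -- The smallest of the `n+1` terms of the geometric sum is `rⁿ`, and `1-r` times that sum is
      -- `1 - r^(n+1) ≤ 1`.
      have hs : ((n : ℝ) + 1) * r ^ n ≤ ∑ i ∈ Finset.range (n + 1), r ^ i := by
        have := Finset.card_nsmul_le_sum (Finset.range (n + 1)) (fun i => r ^ i) (r ^ n)
          fun i hi => pow_le_pow_of_le_one hr.1.le hr.2.le (by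
            have := Finset.mem_range.mp hi; omega)
        simpa using this
      have hgs := mul_neg_geom_sum r (n + 1)
      have : 0 ≤ r ^ (n + 1) := pow_nonneg hr.1.le _
      nlinarith [mul_le_mul_of_nonneg_left hs (sub_nonneg.mpr hr.2.le)]
    have h2 : ‖((1 - r : ℝ) : ℂ) * (PowerSeries.coeff n g * (r * ζ) ^ n)‖
        = ‖PowerSeries.coeff n g‖ * ((1 - r) * r ^ n) := by
      rw [norm_mul, norm_mul, norm_pow, norm_mul, hζ, Complex.norm_real, Complex.norm_real,
        Real.norm_of_nonneg (sub_nonneg.mpr hr.2.le), Real.norm_of_nonneg hr.1.le]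
      ring
    rw [h2]
    gcongr

/-! ### The backward shift -/

/-- The backward shift on power series. -/
def bshift : Module.End ℂ (PowerSeries ℂ) where
  toFun g := PowerSeries.mk fun n => PowerSeries.coeff (n + 1) g
  map_add' g h := by ext; simp
  map_smul' c g := by ext; simp

@[simp]
theorem coeff_bshift (g : PowerSeries ℂ) (n : ℕ) :
    PowerSeries.coeff n (bshift g) = PowerSeries.coeff (n + 1) g := by
  simp [bshift]

theorem bshift_X_mul (g : PowerSeries ℂ) : bshift (PowerSeries.X * g) = g := by
  ext; simp

theorem bshift_coe (p : ℂ[X]) : bshift (p : PowerSeries ℂ) = (p.divX : ℂ[X]) := by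
  ext; simp [Polynomial.coeff_divX]

theorem X_mul_bshift_add (g : PowerSeries ℂ) :
    PowerSeries.X * bshift g + PowerSeries.C (PowerSeries.coeff 0 g) = g := by
  ext n
  cases n <;> simp

theorem SqSummable.bshift {g : PowerSeries ℂ} (hg : SqSummable g) :
    SqSummable (bshift g) := by
  simpa [SqSummable] using (summable_nat_add_iff 1).mpr hg

theorem coeff_aeval_bshift (q : ℂ[X]) (g : PowerSeries ℂ) (n : ℕ) :
    PowerSeries.coeff n (aeval bshift q g) =
      q.sum fun j c => c * PowerSeries.coeff (n + j) g := by
  have hpow : ∀ (j n : ℕ) (g : PowerSeries ℂ), PowerSeries.coeff n ((bshift ^ j) g)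
      = PowerSeries.coeff (n + j) g := by
    intro j
    induction j with
    | zero => simp
    | succ j ih =>
      intro n g
      rw [pow_succ, Module.End.mul_apply, ih, coeff_bshift]
      congr 1
  rw [aeval_eq_sum_range, Polynomial.sum_over_range _ (by simp)]
  simp [LinearMap.sum_apply, hpow]

theorem classA_induction {P : ℂ[X] → Prop} (h1 : P 1)
    (hmul : ∀ (a : ℂ[X]) (ζ : Circle), a ∈ classA → P a → P ((X - C (ζ : ℂ)) * a)) {a : ℂ[X]}
    (ha : a ∈ classA) : P a := by
  obtain ⟨N, ζ, rfl⟩ := ha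
  induction N with
  | zero => simpa using h1
  | succ N ih =>
    rw [Fin.prod_univ_succ]
    exact hmul _ _ ⟨N, _, rfl⟩ (ih _)

theorem X_sub_C_conj (ζ : Circle) (g : PowerSeries ℂ) :
    aeval bshift ((X - C (ζ : ℂ)).map (starRingEnd ℂ)) g = bshift g - conj (ζ : ℂ) • g := by
  simp

theorem C_conj_mul_C (ζ : Circle) :
    PowerSeries.C (conj (ζ : ℂ)) * PowerSeries.C (ζ : ℂ) = 1 := by
  rw [← map_mul, ← Circle.coe_inv_eq_conj, ← Circle.coe_mul]
  simp

/-- Gives `a H² ⊂ 𝓜(ā)`. For one factor, `(S* - ζ̄)(-ζ z k) = (z - ζ) k`, so `-ζ z h` replaces `h`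
at each induction step. -/
theorem exists_aeval_bshift_eq_coe_mul {a : ℂ[X]} (ha : a ∈ classA) :
    ∀ h : PowerSeries ℂ, SqSummable h → ∃ g, SqSummable g ∧
      aeval bshift (a.map (starRingEnd ℂ)) g = (a : PowerSeries ℂ) * h := by
  refine classA_induction (P := fun a => ∀ h : PowerSeries ℂ, SqSummable h → ∃ g, SqSummable g ∧
    aeval bshift (a.map (starRingEnd ℂ)) g = (a : PowerSeries ℂ) * h)
    (fun h hh => ⟨h, hh, by simp⟩) (fun a ζ _ ih h hh => ?_) ha
  obtain ⟨g, hg, e⟩ := ih _ (hh.X_mul.smul (-(ζ : ℂ)))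
  refine ⟨g, hg, ?_⟩
  rw [Polynomial.map_mul, map_mul, Module.End.mul_apply, e, X_sub_C_conj]
  have e1 : (a : PowerSeries ℂ) * (-(ζ : ℂ) • (PowerSeries.X * h))
      = PowerSeries.X * (-(ζ : ℂ) • ((a : PowerSeries ℂ) * h)) := by
    simp only [PowerSeries.smul_eq_C_mul]; ring
  rw [e1, bshift_X_mul]
  simp only [PowerSeries.smul_eq_C_mul, Polynomial.coe_mul, Polynomial.coe_sub,
    Polynomial.coe_X, Polynomial.coe_C, map_neg]
  linear_combination (PowerSeries.X * (a : PowerSeries ℂ) * h) * C_conj_mul_C ζ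

theorem bshift_coe_mul (a : ℂ[X]) (h : PowerSeries ℂ) :
    bshift ((a : PowerSeries ℂ) * h) =
      (a : PowerSeries ℂ) * bshift h +
        PowerSeries.C (PowerSeries.coeff 0 h) * (a.divX : ℂ[X]) := by
  have e : (a : PowerSeries ℂ) * h = PowerSeries.X * ((a : PowerSeries ℂ) * bshift h) +
      PowerSeries.coeff 0 h • (a : PowerSeries ℂ) := by
    conv_lhs => rw [← X_mul_bshift_add h]
    rw [PowerSeries.smul_eq_C_mul]; ring
  rw [e, map_add, bshift_X_mul, map_smul, bshift_coe, PowerSeries.smul_eq_C_mul]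

/-- Gives `𝓜(ā) ⊂ a H² + polynomials`. Substituting `h = z S*h + h(0)` in `(S* - ζ̄)(a h)` leaves
`(1 - ζ̄ z) a S*h = -ζ̄ (z - ζ) a S*h` plus a polynomial, whose degree need not be tracked. -/
theorem exists_coe_mul_add_eq_aeval_bshift {a : ℂ[X]} (ha : a ∈ classA) :
    ∀ g : PowerSeries ℂ, SqSummable g → ∃ (h : PowerSeries ℂ) (p : ℂ[X]), SqSummable h ∧
      aeval bshift (a.map (starRingEnd ℂ)) g = (a : PowerSeries ℂ) * h + p := by
  refine classA_induction (P := fun a => ∀ g : PowerSeries ℂ, SqSummable g →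
    ∃ (h : PowerSeries ℂ) (p : ℂ[X]), SqSummable h ∧
      aeval bshift (a.map (starRingEnd ℂ)) g = (a : PowerSeries ℂ) * h + p) (fun g hg => ⟨g, 0, hg, by simp⟩) (fun a ζ _ ih g hg => ?_) ha
  obtain ⟨h, p, hh, e⟩ := ih g hg
  refine ⟨-conj (ζ : ℂ) • bshift h, C (PowerSeries.coeff 0 h) * a.divX + p.divX
    - C (conj (ζ : ℂ)) * (p + C (PowerSeries.coeff 0 h) * a), hh.bshift.smul _, ?_⟩
  rw [Polynomial.map_mul, map_mul, Module.End.mul_apply, e, X_sub_C_conj, map_add,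
    bshift_coe_mul, bshift_coe]
  simp only [PowerSeries.smul_eq_C_mul, Polynomial.coe_mul, Polynomial.coe_sub, Polynomial.coe_add,
    Polynomial.coe_X, Polynomial.coe_C, map_neg]
  have e2 := X_mul_bshift_add h
  linear_combination (PowerSeries.C (conj (ζ : ℂ)) * a) * e2
    - ((a : PowerSeries ℂ) * bshift h) * C_conj_mul_C ζ

/-! ### Boundary functions and power series -/

/-- The power series of an `H²` function. -/
def series (f : H2) : PowerSeries ℂ := PowerSeries.mk fun n => fourierCoeff (f : L2) (n : ℤ)

theorem toDisc_eq_discEval (f : H2) (z : 𝔻) : toDisc f z = discEval (series f) z := by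
  simp [toDisc, discEval, series]

theorem sqSummable_series (f : H2) : SqSummable (series f) := by
  have := (hasSum_sq_fourierCoeff (f : L2)).summable.comp_injective Nat.cast_injective
  simpa [SqSummable, series, Function.comp_def] using this

theorem exists_series_eq {g : PowerSeries ℂ} (hg : SqSummable g) : ∃ f : H2, series f = g := by
  let c : ℤ → ℂ := fun n => if 0 ≤ n then PowerSeries.coeff n.toNat g else 0
  have hc : Memℓp c 2 := by
    refine memℓp_gen ?_
    refine (Function.Injective.summable_iff (Nat.cast_injective (R := ℤ)) ?_).mp ?_
    · intro n hn
      have : ¬ 0 ≤ n := fun h => hn ⟨n.toNat, by simpa using h⟩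
      simp [c, this]
    · simpa [c, Function.comp_def, SqSummable] using hg
  have hrepr : ∀ n, fourierCoeff (fourierBasis.repr.symm ⟨c, hc⟩ : L2) n = c n := by
    intro n
    rw [← fourierBasis_repr, LinearIsometryEquiv.apply_symm_apply]
  refine ⟨⟨fourierBasis.repr.symm ⟨c, hc⟩, fun n hn => ?_⟩, ?_⟩
  · rw [hrepr]
    simp [c, not_le.mpr hn]
  · ext n
    simp [series, hrepr, c]

theorem fourierBasis_mem_H2 (n : ℕ) : (fourierBasis (n : ℤ) : L2) ∈ H2 := by
  intro m hm
  rw [← fourierBasis_repr, HilbertBasis.repr_self]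
  exact lp.single_apply_ne _ _ _ (by omega)

theorem fourierCoeff_orthogonalProjectionOnto (v : L2) (n : ℕ) :
    fourierCoeff (H2.orthogonalProjectionOnto v : L2) (n : ℤ) = fourierCoeff v (n : ℤ) := by
  rw [← fourierBasis_repr, ← fourierBasis_repr, HilbertBasis.repr_apply_apply,
    HilbertBasis.repr_apply_apply]
  exact Submodule.inner_orthogonalProjectionOnto_eq_of_mem_left
    (⟨_, fourierBasis_mem_H2 n⟩ : H2) v

/-- `P₊` keeps the coefficients of index `n ≥ 0`, and multiplication by `z̄ʲ` moves coefficient `n +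
j` to `n`; hence `T_ā = ā(S*)`. -/
theorem series_toeplitz_star_bdry (a : ℂ[X]) (f : H2) :
    series (toeplitz (star (bdry a)) f) =
      aeval bshift (a.map (starRingEnd ℂ)) (series f) := by
  ext n
  rw [coeff_aeval_bshift, Polynomial.sum_def,
    Polynomial.support_map_of_injective _ (starRingEnd ℂ).injective]
  simp only [series, PowerSeries.coeff_mk, toeplitz, fourierCoeff_orthogonalProjectionOnto,
    Polynomial.coeff_map]
  have hfi : Integrable (fun t => (f : L2) t) (haarAddCircle : Measure UnitAddCircle) :=
    (Lp.memLp (f : L2)).integrable one_le_two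
  have hae : ((star (bdry a) • (f : L2) : L2) : UnitAddCircle → ℂ) =ᵐ[haarAddCircle]
      ∑ j ∈ a.support, fun t => conj (a.coeff j) • (fourier (-(j : ℤ)) t • (f : L2) t) := by
    have h3 : (bdry a : UnitAddCircle → ℂ) =ᵐ[haarAddCircle]
        fun x => a.eval (toCircle x : ℂ) := ContinuousMap.coeFn_toLp _ _
    filter_upwards [Lp.coeFn_lpSMul (r := 2) (star (bdry a)) (f : L2), Lp.coeFn_star (bdry a), h3]
      with t h1 h2 h3
    rw [h1, Pi.smul_apply', h2, Pi.star_apply, h3, Polynomial.eval_eq_sum, Polynomial.sum,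
      star_sum, Finset.sum_smul, Finset.sum_apply]
    refine Finset.sum_congr rfl fun j _ => ?_
    rw [star_mul', smul_smul, smul_eq_mul, smul_eq_mul, fourier_neg, fourier_apply,
      natCast_zsmul, toCircle_nsmul]
    simp
  rw [fourierCoeff_congr_ae hae, fourierCoeff.sum, Finset.sum_apply]
  · refine Finset.sum_congr rfl fun j _ => ?_
    have := fourierCoeff.const_smul
      (fun t => fourier (-(j : ℤ)) t • (f : L2) t) (conj (a.coeff j)) n
    rw [show (fun t => conj (a.coeff j) • (fourier (-(j : ℤ)) t • (f : L2) t)) =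
      conj (a.coeff j) • fun t => fourier (-(j : ℤ)) t • (f : L2) t from rfl, this, smul_eq_mul]
    congr 1
    refine integral_congr_ae (ae_of_all _ fun t => ?_)
    simp only [smul_smul]
    rw [← fourier_add]
    push_cast
    rw [neg_add]
  · intro j _
    exact Integrable.smul (conj (a.coeff j)) (hfi.fourier_smul (-(j : ℤ)))

theorem mem_rangeSpace_iff {a : ℂ[X]} {F : 𝔻 → ℂ} :
    F ∈ rangeSpace (bdry a) ↔ ∃ g, SqSummable g ∧
      ∀ z : 𝔻, F z = discEval (aeval bshift (a.map (starRingEnd ℂ)) g) z := by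
  constructor
  · rintro ⟨f, rfl⟩
    refine ⟨series f, sqSummable_series f, fun z => ?_⟩
    rw [toDisc_eq_discEval, series_toeplitz_star_bdry]
  · rintro ⟨g, hg, h⟩
    obtain ⟨f, rfl⟩ := exists_series_eq hg
    refine ⟨f, funext fun z => ?_⟩
    rw [h, toDisc_eq_discEval, series_toeplitz_star_bdry]

theorem mem_rangeSpace_of_eq_mul {a : ℂ[X]} (ha : a ∈ classA) {h : PowerSeries ℂ}
    (hh : SqSummable h) {F : 𝔻 → ℂ} (hF : ∀ z : 𝔻, F z = a.eval (z : ℂ) * discEval h z) :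
    F ∈ rangeSpace (bdry a) := by
  obtain ⟨g, hg, e⟩ := exists_aeval_bshift_eq_coe_mul ha h hh
  refine mem_rangeSpace_iff.mpr ⟨g, hg, fun z => ?_⟩
  rw [e, discEval_mul (sqSummable_coe a).discSummable hh.discSummable z.norm_lt_one, hF,
    discEval_coe]

theorem exists_eq_mul_add_of_mem_rangeSpace {a : ℂ[X]} (ha : a ∈ classA) {F : 𝔻 → ℂ}
    (hF : F ∈ rangeSpace (bdry a)) :
    ∃ (h : PowerSeries ℂ) (p : ℂ[X]), SqSummable h ∧
      ∀ z : 𝔻, F z = a.eval (z : ℂ) * discEval h z + p.eval (z : ℂ) := by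
  obtain ⟨g, hg, e⟩ := mem_rangeSpace_iff.mp hF
  obtain ⟨h, p, hh, e2⟩ := exists_coe_mul_add_eq_aeval_bshift ha g hg
  refine ⟨h, p, hh, fun z => ?_⟩
  rw [e, e2, discEval_add (hh.coe_mul a).discSummable (sqSummable_coe p).discSummable
    z.norm_lt_one, discEval_mul (sqSummable_coe a).discSummable hh.discSummable z.norm_lt_one,
    discEval_coe, discEval_coe]

/-! ### Bounded analytic functions multiply `H²` -/

theorem norm_mul_toCircle_lt_one {r : ℝ} (h0 : 0 ≤ r) (h1 : r < 1) (t : UnitAddCircle) :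
    ‖(r : ℂ) * toCircle t‖ < 1 := by
  rw [norm_mul, Circle.norm_coe, mul_one, Complex.norm_real, Real.norm_of_nonneg h0]
  exact h1

/-- Parseval on the circle of radius `r < 1`, where the series converges uniformly. -/
theorem exists_continuousMap_eq_discEval {g : PowerSeries ℂ} (hg : DiscSummable g) {r : ℝ}
    (h0 : 0 ≤ r) (h1 : r < 1) : ∃ F : C(UnitAddCircle, ℂ),
      (∀ t, F t = discEval g (r * toCircle t)) ∧
      HasSum (fun n => ‖PowerSeries.coeff n g‖ ^ 2 * (r ^ n) ^ 2)
        (∫ t, ‖F t‖ ^ 2 ∂(haarAddCircle : Measure UnitAddCircle)) := by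
  let c : ℕ → ℂ := fun n => PowerSeries.coeff n g * r ^ n
  have hsum : Summable fun n : ℕ => c n • (fourier (n : ℤ) : C(UnitAddCircle, ℂ)) := by
    refine Summable.of_norm ?_
    have := hg r (by simpa [abs_of_nonneg h0] using h1)
    refine this.congr fun n => ?_
    rw [norm_smul, fourier_norm, mul_one]
  obtain ⟨F, hF⟩ := hsum
  have hFt : ∀ t, F t = discEval g (r * toCircle t) := by
    intro t
    have h2 : HasSum (fun n : ℕ => (c n • (fourier (n : ℤ) : C(UnitAddCircle, ℂ))) t) (F t) :=
      ContinuousMap.hasSum_apply hF t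
    rw [← h2.tsum_eq]
    refine tsum_congr fun n => ?_
    rw [ContinuousMap.smul_apply, fourier_apply, natCast_zsmul, toCircle_nsmul, mul_pow]
    simp [c, mul_assoc]
  refine ⟨F, hFt, ?_⟩
  have hcoeff : ∀ m : ℤ, HasSum (fun n : ℕ => if (n : ℤ) = m then c n else 0)
      (fourierCoeff F m) := by
    intro m
    have h2 := (hF.mapL (ContinuousMap.toLp 2 (haarAddCircle : Measure UnitAddCircle) ℂ)).mapL
      (innerSL ℂ (fourierBasis m : L2))
    rw [innerSL_apply_apply, ← HilbertBasis.repr_apply_apply, fourierBasis_repr,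
      fourierCoeff_toLp] at h2
    convert! h2 using 2 with n
    rw [map_smul, map_smul, innerSL_apply_apply, ← HilbertBasis.repr_apply_apply,
      fourierBasis_repr, fourierCoeff_toLp, fourierCoeff_fourier]
    simp [Pi.single_apply, eq_comm]
  have hnat : ∀ n : ℕ, fourierCoeff F (n : ℤ) = c n := fun n =>
    (hcoeff n).unique (by
      convert! hasSum_ite_eq n (c n) using 2 with m
      split_ifs with h1 h2 h2 <;> simp_all)
  have hneg : ∀ m : ℤ, m ∉ Set.range (Nat.cast : ℕ → ℤ) → fourierCoeff F m = 0 := by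
    intro m hm
    refine (hcoeff m).unique ?_
    convert! hasSum_zero using 2 with n
    rw [if_neg fun h => hm ⟨n, h⟩]
  have h3 := hasSum_sq_fourierCoeff
    (ContinuousMap.toLp 2 (haarAddCircle : Measure UnitAddCircle) ℂ F)
  simp only [fourierCoeff_toLp] at h3
  have h4 : ∫ t, ‖(ContinuousMap.toLp 2 (haarAddCircle : Measure UnitAddCircle) ℂ F : L2) t‖ ^ 2
      ∂haarAddCircle = ∫ t, ‖F t‖ ^ 2 ∂haarAddCircle := by
    refine integral_congr_ae ?_
    filter_upwards [ContinuousMap.coeFn_toLp (p := 2) (𝕜 := ℂ) haarAddCircle F] with t ht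
    rw [ht]
  rw [h4, ← Function.Injective.hasSum_iff (Nat.cast_injective (R := ℤ))
    (fun m hm => by simp [hneg m hm])] at h3
  convert! h3 using 2 with n
  simp [hnat, c, mul_pow, abs_of_nonneg h0]

/-- Parseval on radius `r` bounds the partial sums for `k g` uniformly in `r`; then `r → 1` in each
finite sum. -/
theorem SqSummable.bounded_mul {g k : PowerSeries ℂ} (hg : SqSummable g) (hk : DiscSummable k)
    {M : ℝ} (hM : ∀ z : ℂ, ‖z‖ < 1 → ‖discEval k z‖ ≤ M) : SqSummable (k * g) := by
  have hkg := hk.mul hg.discSummable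
  have hr : ∀ r : ℝ, 0 ≤ r → r < 1 → ∀ N : ℕ,
      ∑ n ∈ Finset.range N, ‖PowerSeries.coeff n (k * g)‖ ^ 2 * (r ^ n) ^ 2 ≤
        M ^ 2 * ∑' n, ‖PowerSeries.coeff n g‖ ^ 2 := by
    intro r h0 h1 N
    obtain ⟨F, hF, hFs⟩ := exists_continuousMap_eq_discEval hkg h0 h1
    obtain ⟨G, hG, hGs⟩ := exists_continuousMap_eq_discEval hg.discSummable h0 h1
    have hint : ∀ H : C(UnitAddCircle, ℂ),
        Integrable (fun t => ‖H t‖ ^ 2) (haarAddCircle : Measure UnitAddCircle) := fun H =>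
      Continuous.integrable_of_hasCompactSupport (by fun_prop) (.of_compactSpace _)
    calc _ ≤ ∫ t, ‖F t‖ ^ 2 ∂(haarAddCircle : Measure UnitAddCircle) :=
          sum_le_hasSum _ (fun n _ => by positivity) hFs
      _ ≤ ∫ t, M ^ 2 * ‖G t‖ ^ 2 ∂(haarAddCircle : Measure UnitAddCircle) := by
          refine integral_mono (hint F) ((hint G).const_mul _) fun t => ?_
          have ht := norm_mul_toCircle_lt_one h0 h1 t
          simp only
          rw [hF, hG, discEval_mul hk hg.discSummable ht, norm_mul, mul_pow]
          gcongr
          exact hM _ ht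
      _ = M ^ 2 * ∫ t, ‖G t‖ ^ 2 ∂(haarAddCircle : Measure UnitAddCircle) :=
          integral_const_mul _ _
      _ ≤ _ := by
          gcongr
          rw [← hGs.tsum_eq]
          refine hGs.summable.tsum_le_tsum (fun n => ?_) hg
          refine mul_le_of_le_one_right (by positivity) ?_
          exact pow_le_one₀ (by positivity) (pow_le_one₀ h0 h1.le)
  refine summable_of_sum_range_le (c := M ^ 2 * ∑' n, ‖PowerSeries.coeff n g‖ ^ 2)
    (fun n => by positivity) fun N => ?_
  have hc : Continuous fun r : ℝ =>
      ∑ n ∈ Finset.range N, ‖PowerSeries.coeff n (k * g)‖ ^ 2 * (r ^ n) ^ 2 := by fun_prop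
  have ht := (hc.tendsto 1).mono_left (nhdsWithin_le_nhds (s := Set.Iio 1))
  simp only [one_pow, mul_one] at ht
  refine le_of_tendsto ht ?_
  filter_upwards [Ioo_mem_nhdsLT zero_lt_one] with r hr'
  exact hr r hr'.1.le hr'.2 N

theorem exists_discEval_eq {f : ℂ → ℂ} (hf : DifferentiableOn ℂ f (Metric.ball 0 1)) :
    ∃ k : PowerSeries ℂ, DiscSummable k ∧ ∀ z : ℂ, ‖z‖ < 1 → discEval k z = f z := by
  have hs : ∀ z : ℂ, ‖z‖ < 1 →
      HasSum (fun n : ℕ => (n.factorial : ℂ)⁻¹ * iteratedDeriv n f 0 * z ^ n) (f z) := by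
    intro z hz
    convert! Complex.hasSum_taylorSeries_on_ball hf (z := z) (by simpa using hz) using 2 with n
    simp only [smul_eq_mul, sub_zero]
    ring
  refine ⟨PowerSeries.mk fun n => (n.factorial : ℂ)⁻¹ * iteratedDeriv n f 0, fun z hz => ?_,
    fun z hz => ?_⟩
  · simpa only [PowerSeries.coeff_mk] using (hs z hz).summable.norm
  · simpa only [discEval, PowerSeries.coeff_mk] using (hs z hz).tsum_eq

/-! ### Polynomials with zeros on the circle -/

theorem eval_ne_zero_of_mem_classA {a : ℂ[X]} (ha : a ∈ classA) {z : ℂ} (hz : ‖z‖ < 1) :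
    a.eval z ≠ 0 := by
  refine classA_induction (P := fun a => a.eval z ≠ 0) (by simp) (fun a ζ _ ih => ?_) ha
  rw [eval_mul]
  refine mul_ne_zero ?_ ih
  rw [eval_sub, eval_X, eval_C, sub_ne_zero]
  rintro rfl
  exact not_lt_of_ge (Circle.norm_coe ζ).ge hz

theorem norm_radial_sub {r : ℝ} (hr : r < 1) (ζ : Circle) :
    ‖(r : ℂ) * ζ - ζ‖ = 1 - r := by
  rw [← sub_one_mul, norm_mul, Circle.norm_coe, mul_one, ← Complex.ofReal_one,
    ← Complex.ofReal_sub, Complex.norm_real, Real.norm_of_nonpos (by linarith), neg_sub]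

theorem tendsto_eval_radial (p : ℂ[X]) (ζ : Circle) :
    Tendsto (fun r : ℝ => p.eval ((r : ℂ) * ζ)) (𝓝[<] 1) (𝓝 (p.eval (ζ : ℂ))) := by
  have : Continuous fun r : ℝ => p.eval ((r : ℂ) * ζ) := by fun_prop
  simpa using (this.tendsto 1).mono_left nhdsWithin_le_nhds

theorem eventually_radial_mem : ∀ᶠ r : ℝ in 𝓝[<] 1, r ∈ Set.Ioo (0 : ℝ) 1 :=
  Ioo_mem_nhdsLT zero_lt_one

/-- The bound forces a zero at `ζ`; dividing out `z - ζ`, of modulus `1-r` on the radius, lowers the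
exponent by one. -/
theorem pow_dvd_of_radial_bound (ζ : Circle) (M : ℝ) (m : ℕ) : ∀ p : ℂ[X],
    (∀ᶠ r : ℝ in 𝓝[<] 1, ‖p.eval ((r : ℂ) * ζ)‖ ≤ M * (1 - r) ^ m) →
      (X - C (ζ : ℂ)) ^ m ∣ p := by
  induction m with
  | zero => simp
  | succ m ih =>
    intro p hp
    have h0 : p.eval (ζ : ℂ) = 0 := by
      have hc : Continuous fun r : ℝ => M * (1 - r) ^ (m + 1) := by fun_prop
      have ht := (hc.tendsto 1).mono_left (nhdsWithin_le_nhds (s := Set.Iio 1))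
      simp only [sub_self, ne_eq, Nat.add_eq_zero_iff, one_ne_zero, and_false, not_false_eq_true,
        zero_pow, mul_zero] at ht
      exact tendsto_nhds_unique (tendsto_eval_radial p ζ) (squeeze_zero_norm' hp ht)
    obtain ⟨q, rfl⟩ := dvd_iff_isRoot.mpr h0
    rw [pow_succ']
    refine mul_dvd_mul_left _ (ih q ?_)
    filter_upwards [hp, eventually_radial_mem] with r hr hr1
    rw [eval_mul, norm_mul, eval_sub, eval_X, eval_C, norm_radial_sub hr1.2] at hr
    have hpos : 0 < 1 - r := sub_pos.mpr hr1.2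
    refine le_of_mul_le_mul_left ?_ hpos
    calc _ ≤ _ := hr
      _ = _ := by ring

theorem norm_radial_lt_one {r : ℝ} (hr : r ∈ Set.Ioo (0 : ℝ) 1) (ζ : Circle) :
    ‖(r : ℂ) * ζ‖ < 1 := by
  rw [norm_mul, Circle.norm_coe, mul_one, Complex.norm_real, Real.norm_of_nonneg hr.1.le]
  exact hr.2

theorem dvd_of_norm_le {q : ℂ[X]} (hq : q ∈ classA) : ∀ (p : ℂ[X]) (M : ℝ),
    (∀ z : ℂ, ‖z‖ < 1 → ‖p.eval z‖ ≤ M * ‖q.eval z‖) → q ∣ p := by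
  refine classA_induction (P := fun q => ∀ (p : ℂ[X]) (M : ℝ),
    (∀ z : ℂ, ‖z‖ < 1 → ‖p.eval z‖ ≤ M * ‖q.eval z‖) → q ∣ p)
    (fun p _ _ => one_dvd p) (fun q ζ hq ih p M hp => ?_) hq
  -- The 2 bounds `|z - ζ|` on the disc, and `|M|` is there because the sign of `M` is not given.
  obtain ⟨s, rfl⟩ := ih p (|M| * 2) fun z hz => by
    refine (hp z hz).trans ?_
    rw [eval_mul, norm_mul, ← mul_assoc]
    gcongr
    · exact le_abs_self M
    · simp only [eval_sub, eval_X, eval_C]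
      refine (norm_sub_le _ _).trans ?_
      rw [Circle.norm_coe]
      linarith
  rw [mul_comm]
  refine mul_dvd_mul_left _ ?_
  rw [← pow_one (X - C (ζ : ℂ))]
  refine pow_dvd_of_radial_bound ζ M 1 s ?_
  filter_upwards [eventually_radial_mem] with r hr
  have hz := norm_radial_lt_one hr ζ
  have h := hp _ hz
  have hq0 : 0 < ‖q.eval ((r : ℂ) * ζ)‖ := norm_pos_iff.mpr (eval_ne_zero_of_mem_classA hq hz)
  rw [eval_mul, eval_mul, norm_mul, norm_mul, eval_sub, eval_X, eval_C,
    norm_radial_sub hr.2] at h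
  refine le_of_mul_le_mul_left ?_ hq0
  calc _ ≤ _ := h
    _ = _ := by ring

theorem eval_circle_of_mem_classA {a : ℂ[X]} (ha : a ∈ classA) {z : ℂ} (hz : a.eval z = 0) :
    ∃ ζ : Circle, z = ζ := by
  obtain ⟨N, ζ, rfl⟩ := ha
  rw [eval_prod, Finset.prod_eq_zero_iff] at hz
  obtain ⟨i, -, hi⟩ := hz
  exact ⟨ζ i, by simpa [sub_eq_zero] using hi⟩

theorem exists_factor_of_quotient_mem_HInf {p q : ℂ[X]} (hp : p ∈ classA) (hq : q ∈ classA)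
    (h : quotient p q ∈ HInf) (hc : ¬ ∃ c : ℂ, ∀ z, quotient p q z = c) :
    ∃ (b : ℂ[X]) (ζ : Circle), p = q * b ∧ b.eval (ζ : ℂ) = 0 := by
  obtain ⟨-, M, hM⟩ := h
  obtain ⟨b, rfl⟩ := dvd_of_norm_le hq p M fun z hz => by
    have h1 := hM (Complex.UnitDisc.mk z hz)
    have h2 : 0 < ‖q.eval z‖ := norm_pos_iff.mpr (eval_ne_zero_of_mem_classA hq hz)
    rwa [quotient, Complex.UnitDisc.coe_mk, norm_div, div_le_iff₀ h2] at h1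
  have hdeg : b.degree ≠ 0 := fun hd => hc ⟨b.coeff 0, fun z => by
    rw [quotient, eval_mul, mul_div_cancel_left₀ _ (eval_ne_zero_of_mem_classA hq z.norm_lt_one),
      eq_C_of_degree_eq_zero hd]
    simp⟩
  obtain ⟨z, hz⟩ := IsAlgClosed.exists_root b hdeg
  obtain ⟨ζ, rfl⟩ := eval_circle_of_mem_classA hp (z := z) (by
    rw [eval_mul, hz.eq_zero, mul_zero])
  exact ⟨b, ζ, rfl, hz⟩

/-- `S*` kills constants, so each factor `S* - ζ̄` only scales them by the nonzero number `-ζ̄`. -/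
theorem one_mem_rangeSpace {a : ℂ[X]} (ha : a ∈ classA) :
    (1 : 𝔻 → ℂ) ∈ rangeSpace (bdry a) := by
  have key : ∃ d : ℂ, aeval bshift (a.map (starRingEnd ℂ)) ((C d : ℂ[X]) : PowerSeries ℂ) =
      ((1 : ℂ[X]) : PowerSeries ℂ) := by
    refine classA_induction (P := fun a => ∃ d : ℂ, aeval bshift (a.map (starRingEnd ℂ))
      ((C d : ℂ[X]) : PowerSeries ℂ) = ((1 : ℂ[X]) : PowerSeries ℂ)) ⟨1, by simp⟩
      (fun a ζ _ ⟨d, hd⟩ => ⟨-(ζ : ℂ) * d, ?_⟩) ha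
    have e : ((C (-(ζ : ℂ) * d) : ℂ[X]) : PowerSeries ℂ) =
        -(ζ : ℂ) • ((C d : ℂ[X]) : PowerSeries ℂ) := by
      rw [PowerSeries.smul_eq_C_mul]; simp
    have e1 : bshift 1 = 0 := by
      simpa using bshift_coe (1 : ℂ[X])
    rw [Polynomial.map_mul, map_mul, Module.End.mul_apply, e, map_smul, hd, X_sub_C_conj,
      map_smul, Polynomial.coe_one, e1, smul_zero, zero_sub, PowerSeries.smul_eq_C_mul,
      PowerSeries.smul_eq_C_mul, map_neg]
    linear_combination C_conj_mul_C ζ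
  obtain ⟨d, hd⟩ := key
  refine mem_rangeSpace_iff.mpr ⟨_, sqSummable_coe (C d), fun z => ?_⟩
  rw [hd, discEval_coe]
  simp

/-! ### A bounded analytic function without radial limit -/

/-- The bounded analytic function `(1 - ζ̄ z)^i`, which oscillates at the boundary point `ζ`. -/
def oscillating (ζ : Circle) (z : ℂ) : ℂ :=
  Complex.exp (Complex.I * Complex.log (1 - conj (ζ : ℂ) * z))

theorem one_sub_mem_slitPlane (ζ : Circle) {z : ℂ} (hz : ‖z‖ < 1) :
    1 - conj (ζ : ℂ) * z ∈ Complex.slitPlane := by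
  refine Or.inl ?_
  have h1 := Complex.re_le_norm (conj (ζ : ℂ) * z)
  rw [norm_mul, RCLike.norm_conj, Circle.norm_coe, one_mul] at h1
  rw [Complex.sub_re, Complex.one_re]
  linarith

theorem differentiableOn_oscillating (ζ : Circle) :
    DifferentiableOn ℂ (oscillating ζ) (Metric.ball 0 1) := by
  intro z hz
  have hz' : ‖z‖ < 1 := by simpa using hz
  have h : DifferentiableAt ℂ (fun z : ℂ => 1 - conj (ζ : ℂ) * z) z := by fun_prop
  exact ((h.clog (one_sub_mem_slitPlane ζ hz')).const_mul _).cexp.differentiableWithinAt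

theorem norm_oscillating_le (ζ : Circle) (z : ℂ) : ‖oscillating ζ z‖ ≤ Real.exp Real.pi := by
  rw [oscillating, Complex.norm_exp, Real.exp_le_exp]
  have := Complex.neg_pi_lt_log_im (1 - conj (ζ : ℂ) * z)
  simp only [Complex.mul_re, Complex.I_re, Complex.I_im, zero_mul, one_mul, zero_sub]
  linarith

/-- At these radii `1 - r = e^{-πn}`, so `(1-r)^i = e^{-iπn}`. -/
theorem oscillating_radial (ζ : Circle) (n : ℕ) :
    oscillating ζ (((1 - Real.exp (-(Real.pi * n)) : ℝ) : ℂ) * ζ) = (-1) ^ n := by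
  have e : 1 - conj (ζ : ℂ) * (((1 - Real.exp (-(Real.pi * n)) : ℝ) : ℂ) * ζ) =
      ((Real.exp (-(Real.pi * n)) : ℝ) : ℂ) := by
    have h : conj (ζ : ℂ) * (ζ : ℂ) = 1 := by
      rw [← Circle.coe_inv_eq_conj, ← Circle.coe_mul, inv_mul_cancel, Circle.coe_one]
    push_cast
    linear_combination (-1 + Complex.exp (-(Real.pi * n))) * h
  rw [oscillating, e, ← Complex.ofReal_log (Real.exp_pos _).le, Real.log_exp]
  have h2 : Complex.I * ((-(Real.pi * n) : ℝ) : ℂ) = n * (-(Real.pi * Complex.I)) := by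
    push_cast; ring
  rw [h2, Complex.exp_nat_mul, Complex.exp_neg, Complex.exp_pi_mul_I]
  norm_num

theorem not_tendsto_oscillating (ζ : Circle) (L : ℂ) :
    ¬ Tendsto (fun r : ℝ => oscillating ζ ((r : ℂ) * ζ)) (𝓝[<] 1) (𝓝 L) := by
  intro h
  have hseq : Tendsto (fun n : ℕ => 1 - Real.exp (-(Real.pi * n))) atTop (𝓝[<] 1) := by
    refine tendsto_nhdsWithin_iff.mpr ⟨?_, Eventually.of_forall fun n => ?_⟩
    · have h1 : Tendsto (fun n : ℕ => Real.exp (-(Real.pi * n))) atTop (𝓝 0) :=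
        Real.tendsto_exp_neg_atTop_nhds_zero.comp
          (tendsto_natCast_atTop_atTop.const_mul_atTop Real.pi_pos)
      simpa using h1.const_sub 1
    · simpa using Real.exp_pos _
  have h2 : Tendsto (fun n : ℕ => (-1 : ℂ) ^ n) atTop (𝓝 L) :=
    (h.comp hseq).congr fun n => oscillating_radial ζ n
  have h3 : Tendsto (fun n : ℕ => (-1 : ℂ) ^ n) atTop (𝓝 (-L)) := by
    refine (tendsto_add_atTop_iff_nat 1).mp ?_
    simpa [pow_succ] using h2.neg
  have h4 : L = 0 := self_eq_neg.mp (tendsto_nhds_unique h2 h3)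
  have h5 := h2.norm
  simp only [norm_pow, norm_neg, norm_one, one_pow, h4, norm_zero] at h5
  exact one_ne_zero (tendsto_nhds_unique tendsto_const_nhds h5)

/-! ### Multipliers -/

theorem mul_oscillating_mul_mem_rangeSpace {c : ℂ[X]} (hc : c ∈ classA) (ζ : Circle)
    {F : 𝔻 → ℂ} (hF : F ∈ rangeSpace (bdry c)) :
    (fun z : 𝔻 => c.eval (z : ℂ) * oscillating ζ z) * F ∈ rangeSpace (bdry c) := by
  obtain ⟨h, p, hh, e⟩ := exists_eq_mul_add_of_mem_rangeSpace hc hF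
  obtain ⟨k, hk, hke⟩ := exists_discEval_eq (differentiableOn_oscillating ζ)
  -- The decomposition of `F` serves only to show that `F` is in `H²`.
  have hG : SqSummable ((c : PowerSeries ℂ) * h + p) := (hh.coe_mul c).add (sqSummable_coe p)
  refine mem_rangeSpace_of_eq_mul hc
    (hG.bounded_mul hk (M := Real.exp Real.pi) fun z hz => ?_) fun z => ?_
  · rw [hke z hz]
    exact norm_oscillating_le ζ z
  · have hz := z.norm_lt_one
    rw [discEval_mul hk hG.discSummable hz, hke _ hz,
      discEval_add (hh.coe_mul c).discSummable (sqSummable_coe p).discSummable hz,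
      discEval_mul (sqSummable_coe c).discSummable hh.discSummable hz, discEval_coe,
      discEval_coe, ← e, Pi.mul_apply, mul_assoc]

theorem mul_oscillating_notMem_rangeSpace {c b : ℂ[X]} (hc : c ∈ classA) (hcb : c * b ∈ classA)
    {ζ : Circle} (hb : b.eval (ζ : ℂ) = 0) :
    (fun z : 𝔻 => c.eval (z : ℂ) * oscillating ζ z) ∉ rangeSpace (bdry (c * b)) := by
  intro hmem
  obtain ⟨h, p, hh, e⟩ := exists_eq_mul_add_of_mem_rangeSpace hcb hmem
  have hc0 : c ≠ 0 := by
    rintro rfl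
    exact eval_ne_zero_of_mem_classA hc (z := 0) (by simp) (by simp)
  -- `c` may itself vanish at `ζ`; its full power of `z - ζ` is split off so that `c₀` can be
  -- divided by near `ζ`.
  obtain ⟨c₀, hcc, hndvd⟩ := exists_eq_pow_rootMultiplicity_mul_and_not_dvd c hc0 (ζ : ℂ)
  set m := c.rootMultiplicity (ζ : ℂ)
  have hc₀ : c₀.eval (ζ : ℂ) ≠ 0 := fun h0 => hndvd (dvd_iff_isRoot.mpr h0)
  obtain ⟨b₀, rfl⟩ := dvd_iff_isRoot.mpr hb
  -- the part of the quotient involving `h` vanishes along the radius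
  have hbh : Tendsto (fun r : ℝ => ((X - C (ζ : ℂ)) * b₀).eval ((r : ℂ) * ζ) *
      discEval h ((r : ℂ) * ζ)) (𝓝[<] 1) (𝓝 0) := by
    have h1 := ((tendsto_one_sub_mul_discEval hh (Circle.norm_coe ζ)).mul
      (tendsto_eval_radial b₀ ζ)).const_mul (-(ζ : ℂ))
    rw [zero_mul, mul_zero] at h1
    refine h1.congr fun r => ?_
    rw [eval_mul, eval_sub, eval_X, eval_C]
    push_cast
    ring
  have eq1 : ∀ᶠ r : ℝ in 𝓝[<] 1, p.eval ((r : ℂ) * ζ) = ((r : ℂ) * ζ - ζ) ^ m *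
      (c₀.eval ((r : ℂ) * ζ) * (oscillating ζ ((r : ℂ) * ζ) -
        ((X - C (ζ : ℂ)) * b₀).eval ((r : ℂ) * ζ) * discEval h ((r : ℂ) * ζ))) := by
    filter_upwards [eventually_radial_mem] with r hr
    have h1 := e (Complex.UnitDisc.mk _ (norm_radial_lt_one hr ζ))
    simp only [Complex.UnitDisc.coe_mk] at h1
    have h2 : c.eval ((r : ℂ) * ζ) = ((r : ℂ) * ζ - ζ) ^ m * c₀.eval ((r : ℂ) * ζ) := by
      conv_lhs => rw [hcc]
      simp
    rw [eval_mul (p := c), h2] at h1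
    linear_combination -h1
  -- Since `k - b h` is bounded on the radius, `p = c (k - b h)` is `O((1-r)^m)`.
  have hdvd : (X - C (ζ : ℂ)) ^ m ∣ p := by
    refine pow_dvd_of_radial_bound ζ
      ((‖c₀.eval (ζ : ℂ)‖ + 1) * (Real.exp Real.pi + 1)) m p ?_
    have hn1 := (tendsto_eval_radial c₀ ζ).norm.eventually_le_const (lt_add_one _)
    have hn2 := hbh.norm.eventually_le_const (u := 1) (by simp)
    filter_upwards [eq1, hn1, hn2, eventually_radial_mem] with r h1 h2 h3 hr
    rw [h1, norm_mul, norm_pow, norm_radial_sub hr.2, norm_mul, mul_comm]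
    have : 0 ≤ 1 - r := sub_nonneg.mpr hr.2.le
    gcongr
    exact (norm_sub_le _ _).trans (add_le_add (norm_oscillating_le _ _) h3)
  obtain ⟨p₀, rfl⟩ := hdvd
  -- After cancelling `(z - ζ)^m`, `k = b h + p₀ / c₀` near the end of the radius, and both terms
  -- converge.
  refine not_tendsto_oscillating ζ (0 + p₀.eval (ζ : ℂ) / c₀.eval (ζ : ℂ))
    ((hbh.add ((tendsto_eval_radial p₀ ζ).div (tendsto_eval_radial c₀ ζ) hc₀)).congr' ?_)
  filter_upwards [eq1, eventually_radial_mem,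
    (tendsto_eval_radial c₀ ζ).eventually_ne hc₀] with r h1 hr hne
  have hpos : ((r : ℂ) * ζ - ζ) ^ m ≠ 0 := pow_ne_zero _ (by
    rw [← norm_pos_iff, norm_radial_sub hr.2]
    exact sub_pos.mpr hr.2)
  rw [eval_mul, eval_pow, eval_sub, eval_X, eval_C] at h1
  rw [Pi.div_apply, mul_left_cancel₀ hpos h1, mul_div_cancel_left₀ _ hne]
  ring

/-- Valid for arbitrary sets of functions: `φ ψ = 1` for some `ψ` in `M₁`, so `φ` can be cancelled
from `φ g = u φ f`. -/
theorem multiplies_iff_of_image_eq {M₁ M₂ : Set (𝔻 → ℂ)} {φ : 𝔻 → ℂ} (h1 : 1 ∈ M₂)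
    (h : (fun f => φ * f) '' M₁ = M₂) (u : 𝔻 → ℂ) :
    (∀ f ∈ M₁, u * f ∈ M₁) ↔ ∀ f ∈ M₂, u * f ∈ M₂ := by
  subst h
  obtain ⟨ψ, -, hψ⟩ := h1
  constructor
  · rintro hu _ ⟨f, hf, rfl⟩
    exact ⟨u * f, hu f hf, mul_left_comm _ _ _⟩
  · intro hu f hf
    obtain ⟨g, hg, e⟩ := hu _ ⟨f, hf, rfl⟩
    simp only at e hψ
    have : g = u * f := by
      linear_combination ψ * e + (u * f - g) * hψ
    exact this ▸ hg

theorem not_multiplies_iff {c b : ℂ[X]} (hc : c ∈ classA) (hcb : c * b ∈ classA)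
    {ζ : Circle} (hb : b.eval (ζ : ℂ) = 0) :
    ¬ ∀ u : 𝔻 → ℂ, (∀ f ∈ rangeSpace (bdry c), u * f ∈ rangeSpace (bdry c)) →
      ∀ f ∈ rangeSpace (bdry (c * b)), u * f ∈ rangeSpace (bdry (c * b)) := by
  intro h
  refine mul_oscillating_notMem_rangeSpace hc hcb hb ?_
  have := h _ (fun f hf => mul_oscillating_mul_mem_rangeSpace hc ζ hf) 1 (one_mem_rangeSpace hcb)
  rwa [mul_one] at this

end RangeSpaces

end

theorem theorem4p1 (a₁ a₂ : Polynomial ℂ)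
    (ha₁ : a₁ ∈ RangeSpaces.classA) (ha₂ : a₂ ∈ RangeSpaces.classA) :
    ((RangeSpaces.quotient a₂ a₁ ∈ RangeSpaces.HInf ∧
        ¬ ∃ c : ℂ, ∀ z, RangeSpaces.quotient a₂ a₁ z = c) →
      ¬ ∃ φ ∈ RangeSpaces.multipliers
            (RangeSpaces.rangeSpace (RangeSpaces.bdry a₁))
            (RangeSpaces.rangeSpace (RangeSpaces.bdry a₂)),
          (fun f => φ * f) '' RangeSpaces.rangeSpace (RangeSpaces.bdry a₁) =
            RangeSpaces.rangeSpace (RangeSpaces.bdry a₂)) ∧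
    ((RangeSpaces.quotient a₁ a₂ ∈ RangeSpaces.HInf ∧
        ¬ ∃ c : ℂ, ∀ z, RangeSpaces.quotient a₁ a₂ z = c) →
      ¬ ∃ φ ∈ RangeSpaces.multipliers
            (RangeSpaces.rangeSpace (RangeSpaces.bdry a₁))
            (RangeSpaces.rangeSpace (RangeSpaces.bdry a₂)),
          (fun f => φ * f) '' RangeSpaces.rangeSpace (RangeSpaces.bdry a₁) =
            RangeSpaces.rangeSpace (RangeSpaces.bdry a₂)) := by
  constructor
  · rintro ⟨hq, hn⟩ ⟨φ, -, h⟩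
    obtain ⟨b, ζ, rfl, hb⟩ := RangeSpaces.exists_factor_of_quotient_mem_HInf ha₂ ha₁ hq hn
    exact RangeSpaces.not_multiplies_iff ha₁ ha₂ hb fun u =>
      (RangeSpaces.multiplies_iff_of_image_eq (RangeSpaces.one_mem_rangeSpace ha₂) h u).mp
  · rintro ⟨hq, hn⟩ ⟨φ, -, h⟩
    obtain ⟨b, ζ, rfl, hb⟩ := RangeSpaces.exists_factor_of_quotient_mem_HInf ha₁ ha₂ hq hn
    -- Here the divisor is `a₂`, so self-multipliers are transferred back from the target to the
    -- source.
    exact RangeSpaces.not_multiplies_iff ha₂ ha₁ hb fun u =>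
      (RangeSpaces.multiplies_iff_of_image_eq (RangeSpaces.one_mem_rangeSpace ha₂) h u).mpr
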